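/- Let $R$ be an associative ring with identity. A left $R$-module $M$ is called Gorenstein flat if there is an exact sequence of flat left $R$-modules $$\cdots\to F_1\to F_0\to F^0\to F^1\to\cdots$$ such that $M\cong\operatorname{Im}(F_0\to F^0)$ and such that $E\otimes_R-$ leaves the sequence exact for every injective right $R$-module $E$. For an integer $n\ge 0$ write $\operatorname{Gfd}_R(M)\le n$ if there is an exact sequence $0\to G_n\to\cdots\to G_0\to M\to 0$ with every $G_i$ a Gorenstein flat left $R$-module; $\operatorname{Gfd}_R(M)\in\{0,1,2,\dots\}\cup\{\infty\}$ is the least such $n$, and $\infty$ if there is none (in particular $\operatorname{Gfd}_R(0)=0$). The ring $R$ is called left GF-closed if the class of Gorenstein flat left $R$-modules is closed under extensions: for every short exact sequence $0\to A\to B\to C\to 0$ of left $R$-modules with $A$ and $C$ Gorenstein flat, $B$ is Gorenstein flat. Proposition. If $R$ is left GF-closed, then for every family $(M_i)_{i\in I}$ of left $R$-modules $$\operatorname{Gfd}_R\Bigl(\bigoplus_{i\in I}M_i\Bigr)=\sup\{\operatorname{Gfd}_R(M_i)\mid i\in I\},$$ where the supremum is taken in $\{0,1,2,\dots\}\cup\{\infty\}$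 (so it is $0$ if $I$ is empty). -/

import Mathlib

open scoped TensorProduct DirectSum

universe u

namespace GorFlat

section Tensor

/-! Right `R`-modules are modules over `Rᵐᵒᵖ`. Mathlib's `⊗[R]` and `Module.Flat` need a commutative
base, so the tensor product of a right with a left module over an arbitrary ring is built here. -/

variable (R : Type u) [Ring R] (X : Type u) [AddCommGroup X] [Module Rᵐᵒᵖ X]
  (M : Type u) [AddCommGroup M] [Module R M]

/-- The subgroup of `X ⊗_ℤ M` generated by the elements `(x r) ⊗ m - x ⊗ (r m)`. -/
def balancedRel : AddSubgroup (X ⊗[ℤ] M) :=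
  AddSubgroup.closure {t | ∃ (x : X) (r : R) (m : M),
    t = (MulOpposite.op r • x) ⊗ₜ[ℤ] m - x ⊗ₜ[ℤ] (r • m)}

/-- The abelian group `X ⊗_R M` of a right `R`-module `X` and a left `R`-module `M`. -/
abbrev Tensor : Type u := (X ⊗[ℤ] M) ⧸ balancedRel R X M

variable {R X M}
variable {Y : Type u} [AddCommGroup Y] [Module Rᵐᵒᵖ Y] {N : Type u} [AddCommGroup N] [Module R N]

/-- The homomorphism `f ⊗_ℤ g : X ⊗_ℤ M → Y ⊗_ℤ N`. -/
noncomputable def intMap (f : X →ₗ[Rᵐᵒᵖ] Y) (g : M →ₗ[R] N) : X ⊗[ℤ] M →+ Y ⊗[ℤ] N :=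
  (TensorProduct.map f.toAddMonoidHom.toIntLinearMap
    g.toAddMonoidHom.toIntLinearMap).toAddMonoidHom

theorem intMap_tmul (f : X →ₗ[Rᵐᵒᵖ] Y) (g : M →ₗ[R] N) (x : X) (m : M) :
    intMap f g (x ⊗ₜ[ℤ] m) = f x ⊗ₜ[ℤ] g m := rfl

theorem balancedRel_le_comap (f : X →ₗ[Rᵐᵒᵖ] Y) (g : M →ₗ[R] N) :
    balancedRel R X M ≤ (balancedRel R Y N).comap (intMap f g) := by
  refine (AddSubgroup.closure_le _).2 ?_
  rintro _ ⟨x, r, m, rfl⟩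
  refine AddSubgroup.subset_closure ⟨f x, r, g m, ?_⟩
  rw [map_sub, intMap_tmul, intMap_tmul, map_smul, map_smul]

/-- The homomorphism `f ⊗_R g : X ⊗_R M → Y ⊗_R N`. -/
noncomputable def Tensor.map (f : X →ₗ[Rᵐᵒᵖ] Y) (g : M →ₗ[R] N) :
    Tensor R X M →+ Tensor R Y N :=
  QuotientAddGroup.map _ _ (intMap f g) (balancedRel_le_comap f g)

end Tensor

/-- A left `R`-module `M` is flat if `- ⊗_R M` sends injective homomorphisms of right `R`-modules
to injective homomorphisms. -/
def IsFlat (R : Type u) [Ring R] (M : Type u) [AddCommGroup M] [Module R M] : Prop :=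
  ∀ (X Y : Type u) [AddCommGroup X] [AddCommGroup Y] [Module Rᵐᵒᵖ X] [Module Rᵐᵒᵖ Y]
    (f : X →ₗ[Rᵐᵒᵖ] Y), Function.Injective f →
      Function.Injective (Tensor.map f (LinearMap.id : M →ₗ[R] M))

/-- A left `R`-module `M` is Gorenstein flat if there is an exact sequence
`⋯ → F (-1) → F 0 → F 1 → ⋯` of flat left `R`-modules with `M ≅ Im (F 0 → F 1)` that stays exact
under `E ⊗_R -` for every injective right `R`-module `E`. -/
def IsGorensteinFlat (R : Type u) [Ring R] (M : Type u) [AddCommGroup M] [Module R M] : Prop :=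
  ∃ (F : ℤ → ModuleCat.{u} R) (d : ∀ n : ℤ, F n →ₗ[R] F (n + 1)),
    (∀ n, IsFlat R (F n)) ∧
    (∀ n, Function.Exact (d n) (d (n + 1))) ∧
    Nonempty (M ≃ₗ[R] LinearMap.range (d 0)) ∧
    ∀ (E : Type u) [AddCommGroup E] [Module Rᵐᵒᵖ E], Module.Injective Rᵐᵒᵖ E →
      ∀ n, Function.Exact (Tensor.map (LinearMap.id : E →ₗ[Rᵐᵒᵖ] E) (d n))
        (Tensor.map (LinearMap.id : E →ₗ[Rᵐᵒᵖ] E) (d (n + 1)))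

/-- A ring is left GF-closed if its Gorenstein flat left modules are closed under extensions. -/
def IsLeftGFClosed (R : Type u) [Ring R] : Prop :=
  ∀ (A B C : Type u) [AddCommGroup A] [AddCommGroup B] [AddCommGroup C]
    [Module R A] [Module R B] [Module R C] (f : A →ₗ[R] B) (g : B →ₗ[R] C),
    Function.Injective f → Function.Exact f g → Function.Surjective g →
      IsGorensteinFlat R A → IsGorensteinFlat R C → IsGorensteinFlat R B

/-- There is an exact sequence `0 → G n → ⋯ → G 0 → M → 0` with all `G i` Gorenstein flat
(indexed over all of `ℕ`, with `G i = 0` for `i > n`). -/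
def HasGFResolution (R : Type u) [Ring R] (M : Type u) [AddCommGroup M] [Module R M]
    (n : ℕ) : Prop :=
  ∃ (G : ℕ → ModuleCat.{u} R) (d : ∀ i : ℕ, G (i + 1) →ₗ[R] G i) (ε : G 0 →ₗ[R] M),
    (∀ i ≤ n, IsGorensteinFlat R (G i)) ∧
    (∀ i > n, Subsingleton (G i)) ∧
    Function.Surjective ε ∧
    Function.Exact (d 0) ε ∧
    ∀ i, Function.Exact (d (i + 1)) (d i)

/-- The Gorenstein flat dimension: the least length of a resolution by Gorenstein flat modules,
and `⊤` if there is no finite one. -/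
noncomputable def gfd (R : Type u) [Ring R] (M : Type u) [AddCommGroup M] [Module R M] : ℕ∞ :=
  sInf {k : ℕ∞ | ∃ n : ℕ, k = n ∧ HasGFResolution R M n}

end GorFlat

namespace GorFlat

/-! For each finite `n`, dimension at most `n` passes from the summands to the sum and back.

Direct sums of resolutions are resolutions, and sums of Gorenstein flat modules are Gorenstein flat
(`IsGorensteinFlat.directSum`). This half does not use GF-closedness.

Conversely, each `M i` is a retract of the sum, so closure under retracts is needed. In dimension 0
this is an Eilenberg swindle (`IsGorensteinFlat.of_retract`): a retract of `M` is the kernel of an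
epimorphism from the countable sum of copies of `M` onto itself. Over a GF-closed ring kernels of
epimorphisms between Gorenstein flat modules are Gorenstein flat
(`IsGorensteinFlat.of_shortExact_right`). In higher dimension one passes to syzygies: a Schanuel
argument (`GorFlatDimLE.syzygy`) lowers the dimension by one, and a syzygy of a retract is a retract
of a suitable syzygy of `M`.

Tensor products enter only through characters. Since `Hom(E ⊗ M, ℚ/ℤ) = Hom(M, E⁺)`, exactness of `E
⊗ -` becomes a factorization property for maps into `E⁺`, and `Ext(M, E⁺)` takes the place of
`Tor(E, M)`. A Gorenstein flat module is then a module with a two-sided chain of flat short exact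
sequences through Tor-acyclic modules. -/

open CategoryTheory Abelian

/-! ### Character modules and the tensor-hom adjunction. -/

/-- The left `R`-module of characters of a right `R`-module. -/
def RightDual (E : Type u) [AddCommGroup E] : Type u := E →+ AddCircle (1 : ℚ)

/-- The right `R`-module of characters of a left `R`-module. -/
def LeftDual (M : Type u) [AddCommGroup M] : Type u := M →+ AddCircle (1 : ℚ)

section Dual

variable {R : Type u} [Ring R]

noncomputable instance (E : Type u) [AddCommGroup E] : AddCommGroup (RightDual E) :=
  inferInstanceAs (AddCommGroup (E →+ AddCircle (1 : ℚ)))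

noncomputable instance (M : Type u) [AddCommGroup M] : AddCommGroup (LeftDual M) :=
  inferInstanceAs (AddCommGroup (M →+ AddCircle (1 : ℚ)))

instance (E : Type u) [AddCommGroup E] : FunLike (RightDual E) E (AddCircle (1 : ℚ)) :=
  inferInstanceAs (FunLike (E →+ AddCircle (1 : ℚ)) E (AddCircle (1 : ℚ)))

instance (E : Type u) [AddCommGroup E] :
    AddMonoidHomClass (RightDual E) E (AddCircle (1 : ℚ)) :=
  inferInstanceAs (AddMonoidHomClass (E →+ AddCircle (1 : ℚ)) E (AddCircle (1 : ℚ)))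

instance (M : Type u) [AddCommGroup M] : FunLike (LeftDual M) M (AddCircle (1 : ℚ)) :=
  inferInstanceAs (FunLike (M →+ AddCircle (1 : ℚ)) M (AddCircle (1 : ℚ)))

instance (M : Type u) [AddCommGroup M] :
    AddMonoidHomClass (LeftDual M) M (AddCircle (1 : ℚ)) :=
  inferInstanceAs (AddMonoidHomClass (M →+ AddCircle (1 : ℚ)) M (AddCircle (1 : ℚ)))

theorem RightDual.ext {E : Type u} [AddCommGroup E] {φ ψ : RightDual E}
    (h : ∀ x, φ x = ψ x) : φ = ψ := DFunLike.ext _ _ h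

theorem LeftDual.ext {M : Type u} [AddCommGroup M] {φ ψ : LeftDual M}
    (h : ∀ x, φ x = ψ x) : φ = ψ := DFunLike.ext _ _ h

noncomputable instance (E : Type u) [AddCommGroup E] [Module Rᵐᵒᵖ E] :
    Module R (RightDual E) where
  smul r φ := AddMonoidHom.comp φ (DistribSMul.toAddMonoidHom E (MulOpposite.op r))
  one_smul φ := RightDual.ext fun x => congrArg φ (one_smul Rᵐᵒᵖ x)
  mul_smul _ _ φ := RightDual.ext fun x => congrArg φ (mul_smul _ _ x)
  smul_zero _ := rfl
  smul_add _ _ _ := rfl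
  add_smul r s φ := RightDual.ext fun x =>
    (congrArg φ (add_smul (MulOpposite.op r) (MulOpposite.op s) x)).trans (map_add φ _ _)
  zero_smul φ := RightDual.ext fun x => (congrArg φ (zero_smul Rᵐᵒᵖ x)).trans (map_zero φ)

noncomputable instance (M : Type u) [AddCommGroup M] [Module R M] :
    Module Rᵐᵒᵖ (LeftDual M) where
  smul r φ := AddMonoidHom.comp φ (DistribSMul.toAddMonoidHom M r.unop)
  one_smul φ := LeftDual.ext fun x => congrArg φ (one_smul R x)
  mul_smul _ _ φ := LeftDual.ext fun x => congrArg φ (mul_smul _ _ x)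
  smul_zero _ := rfl
  smul_add _ _ _ := rfl
  add_smul r s φ := LeftDual.ext fun x =>
    (congrArg φ (add_smul r.unop s.unop x)).trans (map_add φ _ _)
  zero_smul φ := LeftDual.ext fun x => (congrArg φ (zero_smul R x)).trans (map_zero φ)

variable {E : Type u} [AddCommGroup E] [Module Rᵐᵒᵖ E]
variable {M : Type u} [AddCommGroup M] [Module R M] {N : Type u} [AddCommGroup N] [Module R N]

theorem RightDual.smul_apply (r : R) (φ : RightDual E) (x : E) :
    (r • φ) x = φ (MulOpposite.op r • x) := rfl

/-- Characters extend along injective homomorphisms of abelian groups. -/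
theorem exists_character_extension {A B : Type u} [AddCommGroup A] [AddCommGroup B] (f : A →+ B)
    (hf : Function.Injective f) (χ : A →+ AddCircle (1 : ℚ)) :
    ∃ κ : B →+ AddCircle (1 : ℚ), ∀ a, κ (f a) = χ a := by
  obtain ⟨κ, h⟩ := (Module.Baer.of_divisible (AddCircle (1 : ℚ))).extension_property_addMonoidHom
    f hf χ
  exact ⟨κ, fun a => DFunLike.congr_fun h a⟩

theorem exists_character_of_notMem {A : Type u} [AddCommGroup A] (S : AddSubgroup A) {a : A}
    (ha : a ∉ S) : ∃ χ : A →+ AddCircle (1 : ℚ), (∀ s ∈ S, χ s = 0) ∧ χ a ≠ 0 := by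
  obtain ⟨c, hc⟩ := CharacterModule.exists_character_apply_ne_zero_of_ne_zero
    (a := (QuotientAddGroup.mk a : A ⧸ S)) (by rwa [Ne, QuotientAddGroup.eq_zero_iff])
  refine ⟨AddMonoidHom.comp (c : (A ⧸ S) →+ AddCircle (1 : ℚ)) (QuotientAddGroup.mk' S),
    fun s hs => ?_, hc⟩
  have : (QuotientAddGroup.mk s : A ⧸ S) = 0 := (QuotientAddGroup.eq_zero_iff s).2 hs
  exact (congrArg c this).trans (map_zero c)

/-- A character that vanishes on the kernel of `g` factors through `g`. -/
theorem exists_character_factor {A B : Type u} [AddCommGroup A] [AddCommGroup B] (g : A →+ B)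
    (χ : A →+ AddCircle (1 : ℚ)) (h : ∀ a, g a = 0 → χ a = 0) :
    ∃ κ : B →+ AddCircle (1 : ℚ), ∀ a, κ (g a) = χ a := by
  obtain ⟨κ, hκ⟩ := exists_character_extension (QuotientAddGroup.kerLift g)
    (QuotientAddGroup.kerLift_injective g) (QuotientAddGroup.lift g.ker χ fun a ha => h a ha)
  exact ⟨κ, fun a => hκ (QuotientAddGroup.mk a)⟩

/-- The class of `x ⊗ m` in `X ⊗_R M`. -/
def Tensor.mk (x : E) (m : M) : Tensor R E M := QuotientAddGroup.mk (x ⊗ₜ[ℤ] m)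

theorem Tensor.smul_mk (r : R) (x : E) (m : M) :
    Tensor.mk (R := R) (MulOpposite.op r • x) m = Tensor.mk x (r • m) := by
  rw [← sub_eq_zero]
  exact (QuotientAddGroup.eq_zero_iff (N := balancedRel R E M) _).2
    (AddSubgroup.subset_closure ⟨x, r, m, rfl⟩)

theorem Tensor.mk_add (x : E) (m n : M) :
    Tensor.mk (R := R) x (m + n) = Tensor.mk x m + Tensor.mk x n :=
  congrArg (QuotientAddGroup.mk' (balancedRel R E M)) (TensorProduct.tmul_add x m n)

theorem Tensor.mk_zero (x : E) : Tensor.mk (R := R) x (0 : M) = 0 :=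
  congrArg (QuotientAddGroup.mk' (balancedRel R E M)) (TensorProduct.tmul_zero M x)

theorem Tensor.add_mk (x y : E) (m : M) :
    Tensor.mk (R := R) (x + y) m = Tensor.mk x m + Tensor.mk y m :=
  congrArg (QuotientAddGroup.mk' (balancedRel R E M)) (TensorProduct.add_tmul x y m)

theorem Tensor.induction {p : Tensor R E M → Prop} (h0 : p 0) (h1 : ∀ x m, p (Tensor.mk x m))
    (h2 : ∀ s t, p s → p t → p (s + t)) (t : Tensor R E M) : p t := by
  obtain ⟨t, rfl⟩ := QuotientAddGroup.mk_surjective t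
  induction t with
  | zero => exact h0
  | tmul x m => exact h1 x m
  | add s t hs ht => exact h2 _ _ hs ht

theorem Tensor.addHom_ext {G : Type*} [AddCommGroup G] {f g : Tensor R E M →+ G}
    (h : ∀ x m, f (Tensor.mk x m) = g (Tensor.mk x m)) (t : Tensor R E M) : f t = g t := by
  induction t using Tensor.induction with
  | h0 => simp
  | h1 x m => exact h x m
  | h2 s t hs ht => rw [map_add, map_add, hs, ht]

variable {X : Type u} [AddCommGroup X] [Module Rᵐᵒᵖ X]

theorem Tensor.map_mk (f : E →ₗ[Rᵐᵒᵖ] X) (g : M →ₗ[R] N) (x : E) (m : M) :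
    Tensor.map f g (Tensor.mk x m) = Tensor.mk (f x) (g m) := rfl

/-- The homomorphism `M → E⁺` that belongs to a character of `E ⊗_R M`. -/
def Tensor.curry (χ : Tensor R E M →+ AddCircle (1 : ℚ)) : M →ₗ[R] RightDual E where
  toFun m := (AddMonoidHom.mk' (fun x : E => χ (Tensor.mk x m)) fun x y => by
    rw [Tensor.add_mk, map_add] : E →+ AddCircle (1 : ℚ))
  map_add' m n := RightDual.ext fun x =>
    (congrArg χ (Tensor.mk_add x m n)).trans (map_add χ _ _)
  map_smul' r m := RightDual.ext fun x => (congrArg χ (Tensor.smul_mk r x m)).symm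

theorem Tensor.curry_apply (χ : Tensor R E M →+ AddCircle (1 : ℚ)) (m : M) (x : E) :
    Tensor.curry χ m x = χ (Tensor.mk x m) := rfl

/-- The inverse of `Tensor.curry`: linearity of `h` is exactly what kills the balancing relations.
-/
theorem exists_character_of_hom (h : M →ₗ[R] RightDual E) :
    ∃ χ : Tensor R E M →+ AddCircle (1 : ℚ), ∀ x m, χ (Tensor.mk x m) = h m x := by
  let b : E →+ M →+ AddCircle (1 : ℚ) :=
    AddMonoidHom.flip (h.toAddMonoidHom : M →+ (E →+ AddCircle (1 : ℚ)))
  have hb : ∀ x m, b x m = h m x := fun _ _ => rfl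
  refine ⟨QuotientAddGroup.lift _ (TensorProduct.liftAddHom b fun r x m => by
    rw [map_zsmul, map_zsmul]; rfl) ?_, fun x m => rfl⟩
  refine (AddSubgroup.closure_le _).2 ?_
  rintro _ ⟨x, r, m, rfl⟩
  change TensorProduct.liftAddHom b _ _ = 0
  rw [map_sub, TensorProduct.liftAddHom_tmul, TensorProduct.liftAddHom_tmul, hb, hb, h.map_smul,
    RightDual.smul_apply, sub_self]

variable {A B C : Type u} [AddCommGroup A] [AddCommGroup B] [AddCommGroup C]
  [Module R A] [Module R B] [Module R C]

/-- By adjunction `f` is a character of `E ⊗ B` vanishing on the image of `E ⊗ A`, hence on the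
kernel of the next map, so it factors because `ℚ/ℤ` is injective. -/
theorem exists_hom_factor_of_tensor_exact {a : A →ₗ[R] B} {b : B →ₗ[R] C}
    (h : Function.Exact (Tensor.map (LinearMap.id : E →ₗ[Rᵐᵒᵖ] E) a)
      (Tensor.map (LinearMap.id : E →ₗ[Rᵐᵒᵖ] E) b))
    (f : B →ₗ[R] RightDual E) (hf : ∀ x, f (a x) = 0) :
    ∃ k : C →ₗ[R] RightDual E, ∀ y, k (b y) = f y := by
  obtain ⟨χ, hχ⟩ := exists_character_of_hom f
  have h0 (t : Tensor R E A) : χ (Tensor.map LinearMap.id a t) = 0 :=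
    Tensor.addHom_ext (f := χ.comp (Tensor.map LinearMap.id a)) (g := 0) (fun x m => by
      rw [AddMonoidHom.comp_apply, Tensor.map_mk, hχ, hf]; rfl) t
  obtain ⟨κ, hκ⟩ := exists_character_factor (Tensor.map (LinearMap.id : E →ₗ[Rᵐᵒᵖ] E) b) χ
    fun t ht => by
      obtain ⟨s, rfl⟩ := (h t).1 ht
      exact h0 s
  refine ⟨Tensor.curry κ, fun y => RightDual.ext fun x => ?_⟩
  rw [Tensor.curry_apply, ← hχ, ← hκ, Tensor.map_mk, LinearMap.id_apply]

/-- A tensor in the kernel but outside the image would be detected by a character vanishing on the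
image; the factorization makes that character vanish on the kernel too. -/
theorem tensor_exact_of_hom_factor {a : A →ₗ[R] B} {b : B →ₗ[R] C} (hab : ∀ x, b (a x) = 0)
    (h : ∀ f : B →ₗ[R] RightDual E, (∀ x, f (a x) = 0) →
      ∃ k : C →ₗ[R] RightDual E, ∀ y, k (b y) = f y) :
    Function.Exact (Tensor.map (LinearMap.id : E →ₗ[Rᵐᵒᵖ] E) a)
      (Tensor.map (LinearMap.id : E →ₗ[Rᵐᵒᵖ] E) b) := by
  intro t
  refine ⟨fun ht => ?_, ?_⟩
  · by_contra hn
    obtain ⟨χ, h0, h1⟩ := exists_character_of_notMem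
      (Tensor.map (LinearMap.id : E →ₗ[Rᵐᵒᵖ] E) a).range (a := t) hn
    obtain ⟨k, hk⟩ := h (Tensor.curry χ) fun x => RightDual.ext fun e => h0 _ ⟨Tensor.mk e x, rfl⟩
    obtain ⟨κ, hκ⟩ := exists_character_of_hom k
    refine h1 ?_
    rw [← map_zero κ, ← ht]
    refine Tensor.addHom_ext (f := χ) (g := κ.comp (Tensor.map LinearMap.id b)) (fun x m => ?_) t
    rw [AddMonoidHom.comp_apply, Tensor.map_mk, hκ, hk, LinearMap.id_apply, Tensor.curry_apply]
  · rintro ⟨s, rfl⟩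
    refine Tensor.addHom_ext (f := (Tensor.map LinearMap.id b).comp (Tensor.map LinearMap.id a))
      (g := 0) (fun x m => ?_) s
    rw [AddMonoidHom.comp_apply, Tensor.map_mk, Tensor.map_mk, hab]
    exact Tensor.mk_zero x

/-- The homomorphism of character modules induced by a homomorphism of right modules. -/
def RightDual.map (f : E →ₗ[Rᵐᵒᵖ] X) : RightDual X →ₗ[R] RightDual E where
  toFun φ := AddMonoidHom.comp φ f.toAddMonoidHom
  map_add' _ _ := rfl
  map_smul' r φ := RightDual.ext fun x => congrArg φ (f.map_smul (MulOpposite.op r) x).symm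

theorem RightDual.map_apply (f : E →ₗ[Rᵐᵒᵖ] X) (φ : RightDual X) (x : E) :
    RightDual.map f φ x = φ (f x) := rfl

/-- The homomorphism of character modules induced by a homomorphism of left modules. -/
def LeftDual.map (f : M →ₗ[R] N) : LeftDual N →ₗ[Rᵐᵒᵖ] LeftDual M where
  toFun φ := AddMonoidHom.comp φ f.toAddMonoidHom
  map_add' _ _ := rfl
  map_smul' r φ := LeftDual.ext fun x => congrArg φ (f.map_smul r.unop x).symm

theorem LeftDual.map_surjective (f : M →ₗ[R] N) (hf : Function.Injective f) :
    Function.Surjective (LeftDual.map f) := fun φ => by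
  obtain ⟨κ, hκ⟩ := exists_character_extension f.toAddMonoidHom hf φ
  exact ⟨κ, LeftDual.ext hκ⟩

/-- The character module of a projective right module is injective. -/
theorem injective_rightDual [Module.Projective Rᵐᵒᵖ E] : Module.Injective R (RightDual E) where
  out A B _ _ _ _ f hf g := by
    let g' : E →ₗ[Rᵐᵒᵖ] LeftDual A :=
      { toFun := fun x => (AddMonoidHom.mk' (fun a => g a x) fun a b => by
          rw [map_add]; rfl : A →+ AddCircle (1 : ℚ))
        map_add' := fun x y => LeftDual.ext fun a => map_add (g a) x y
        map_smul' := fun r x => LeftDual.ext fun a =>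
          (congrArg (fun φ : RightDual E => φ x) (g.map_smul r.unop a)).symm }
    obtain ⟨h, hh⟩ := Module.projective_lifting_property (LeftDual.map f) g'
      (LeftDual.map_surjective f hf)
    refine ⟨{ toFun := fun b => (AddMonoidHom.mk' (fun x => h x b) fun x y => by
                rw [map_add]; rfl : E →+ AddCircle (1 : ℚ))
              map_add' := fun b c => RightDual.ext fun x => map_add (h x) b c
              map_smul' := fun r b => RightDual.ext fun x =>
                (congrArg (fun φ : LeftDual B => φ b)
                  (h.map_smul (MulOpposite.op r) x)).symm }, fun a => RightDual.ext fun x => ?_⟩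
    exact congrArg (fun φ : LeftDual A => φ a) (LinearMap.congr_fun hh x)

/-- Adjoint form of extending a character along the injection `E ⊗ M → X ⊗ M`. -/
theorem IsFlat.exists_hom_lift (hM : IsFlat R M) (f : E →ₗ[Rᵐᵒᵖ] X) (hf : Function.Injective f)
    (g : M →ₗ[R] RightDual E) : ∃ k : M →ₗ[R] RightDual X, ∀ m, RightDual.map f (k m) = g m := by
  obtain ⟨χ, hχ⟩ := exists_character_of_hom g
  obtain ⟨κ, hκ⟩ := exists_character_extension _ (hM E X f hf) χ
  refine ⟨Tensor.curry κ, fun m => RightDual.ext fun x => ?_⟩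
  rw [RightDual.map_apply, Tensor.curry_apply, ← hχ, ← hκ]
  rfl

theorem isFlat_of_exists_hom_lift
    (h : ∀ (E X : Type u) [AddCommGroup E] [AddCommGroup X] [Module Rᵐᵒᵖ E] [Module Rᵐᵒᵖ X]
      (f : E →ₗ[Rᵐᵒᵖ] X), Function.Injective f → ∀ g : M →ₗ[R] RightDual E,
        ∃ k : M →ₗ[R] RightDual X, ∀ m, RightDual.map f (k m) = g m) : IsFlat R M := by
  intro E X _ _ _ _ f hf
  rw [injective_iff_map_eq_zero]
  intro t ht
  by_contra hn
  obtain ⟨χ, -, h1⟩ := exists_character_of_notMem (⊥ : AddSubgroup (Tensor R E M)) (a := t) hn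
  obtain ⟨k, hk⟩ := h E X f hf (Tensor.curry χ)
  obtain ⟨κ, hκ⟩ := exists_character_of_hom k
  refine h1 ?_
  rw [← map_zero κ, ← ht]
  refine Tensor.addHom_ext (f := χ) (g := κ.comp (Tensor.map f LinearMap.id)) (fun x m => ?_) t
  rw [AddMonoidHom.comp_apply, Tensor.map_mk, hκ, LinearMap.id_apply, ← RightDual.map_apply, hk,
    Tensor.curry_apply]

theorem RightDual.map_surjective (f : E →ₗ[Rᵐᵒᵖ] X) (hf : Function.Injective f) :
    Function.Surjective (RightDual.map f) := fun φ => by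
  obtain ⟨κ, hκ⟩ := exists_character_extension f.toAddMonoidHom hf φ
  exact ⟨κ, RightDual.ext hκ⟩

theorem RightDual.map_injective (f : E →ₗ[Rᵐᵒᵖ] X) (hf : Function.Surjective f) :
    Function.Injective (RightDual.map f) := fun φ ψ h => RightDual.ext fun y => by
  obtain ⟨x, rfl⟩ := hf y
  exact DFunLike.congr_fun h x

variable {Y : Type u} [AddCommGroup Y] [Module Rᵐᵒᵖ Y]

theorem RightDual.map_exact {f : Y →ₗ[Rᵐᵒᵖ] E} {g : E →ₗ[Rᵐᵒᵖ] X} (h : Function.Exact f g) :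
    Function.Exact (RightDual.map g) (RightDual.map f) := by
  intro φ
  refine ⟨fun hφ => ?_, ?_⟩
  · obtain ⟨κ, hκ⟩ := exists_character_factor g.toAddMonoidHom φ fun x hx => by
      obtain ⟨y, rfl⟩ := (h x).1 hx
      exact DFunLike.congr_fun hφ y
    exact ⟨κ, RightDual.ext hκ⟩
  · rintro ⟨ψ, rfl⟩
    refine RightDual.ext fun y => ?_
    rw [RightDual.map_apply, RightDual.map_apply, h.apply_apply_eq_zero, map_zero]
    rfl

end Dual

/-! ### Vanishing of Ext into character modules. -/

section Ext

variable {R : Type u} [Ring R]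
variable {A B C N : Type u} [AddCommGroup A] [AddCommGroup B] [AddCommGroup C] [AddCommGroup N]
  [Module R A] [Module R B] [Module R C] [Module R N]

/-- The vanishing of `Ext^n_R(M, N)`. -/
def ExtVanishes (R : Type u) [Ring R] (M N : Type u) [AddCommGroup M] [Module R M]
    [AddCommGroup N] [Module R N] (n : ℕ) : Prop :=
  ∀ x : Ext (ModuleCat.of R M) (ModuleCat.of R N) n, x = 0

theorem exists_shortExact (f : A →ₗ[R] B) (g : B →ₗ[R] C) (hf : Function.Injective f)
    (hfg : Function.Exact f g) (hg : Function.Surjective g) :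
    (ShortComplex.mk (ModuleCat.ofHom f) (ModuleCat.ofHom g)
      (by ext x; exact hfg.apply_apply_eq_zero x)).ShortExact where
  exact := (ShortComplex.ShortExact.moduleCat_exact_iff_function_exact _).2 hfg
  mono_f := (ModuleCat.mono_iff_injective _).2 hf
  epi_g := (ModuleCat.epi_iff_surjective _).2 hg

variable {f : A →ₗ[R] B} {g : B →ₗ[R] C}

theorem ExtVanishes.left (hf : Function.Injective f) (hfg : Function.Exact f g)
    (hg : Function.Surjective g) {n : ℕ} (hB : ExtVanishes R B N n)
    (hC : ExtVanishes R C N (n + 1)) : ExtVanishes R A N n := by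
  intro x
  obtain ⟨y, rfl⟩ := Ext.contravariant_sequence_exact₁ (exists_shortExact f g hf hfg hg) _ x
    (n₁ := n + 1) (by omega) (hC _)
  rw [hB y, Ext.comp_zero]

theorem ExtVanishes.right (hf : Function.Injective f) (hfg : Function.Exact f g)
    (hg : Function.Surjective g) {n : ℕ} (hA : ExtVanishes R A N n)
    (hB : ExtVanishes R B N (n + 1)) : ExtVanishes R C N (n + 1) := by
  intro x
  obtain ⟨y, rfl⟩ := Ext.contravariant_sequence_exact₃ (exists_shortExact f g hf hfg hg) _ x
    (hB _) (n₀ := n) (by omega)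
  rw [hA y, Ext.comp_zero]

theorem ExtVanishes.exists_extension (hf : Function.Injective f) (hfg : Function.Exact f g)
    (hg : Function.Surjective g) (hC : ExtVanishes R C N 1) (h : A →ₗ[R] N) :
    ∃ k : B →ₗ[R] N, ∀ a, k (f a) = h a := by
  obtain ⟨y, hy⟩ := Ext.contravariant_sequence_exact₁ (exists_shortExact f g hf hfg hg) _
    (Ext.mk₀ (ModuleCat.ofHom h)) (n₁ := 1) (by omega) (hC _)
  obtain ⟨k, rfl⟩ := Ext.homEquiv₀.symm.surjective y
  have := (Ext.mk₀_comp_mk₀ _ _).symm.trans hy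
  have := (Ext.mk₀_bijective _ _).1 this
  exact ⟨k.hom, fun a => LinearMap.congr_fun (congrArg ModuleCat.Hom.hom this) a⟩

theorem ExtVanishes.of_exists_extension (hf : Function.Injective f) (hfg : Function.Exact f g)
    (hg : Function.Surjective g) (hB : ExtVanishes R B N 1)
    (h : ∀ h : A →ₗ[R] N, ∃ k : B →ₗ[R] N, ∀ a, k (f a) = h a) : ExtVanishes R C N 1 := by
  intro x
  have hS := exists_shortExact f g hf hfg hg
  obtain ⟨y, rfl⟩ := Ext.contravariant_sequence_exact₃ hS _ x (hB _) (n₀ := 0) (by omega)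
  obtain ⟨a, rfl⟩ := Ext.homEquiv₀.symm.surjective y
  obtain ⟨k, hk⟩ := h a.hom
  have : a = ModuleCat.ofHom f ≫ ModuleCat.ofHom k := by ext x; exact (hk x).symm
  change hS.extClass.comp (Ext.mk₀ a) _ = 0
  rw [this, ← Ext.mk₀_comp_mk₀]
  exact hS.extClass_comp_assoc _

theorem ExtVanishes.of_injective_coresolution [Module.Injective R B] {M : Type u} [AddCommGroup M]
    [Module R M] (hf : Function.Injective f) (hfg : Function.Exact f g)
    (hg : Function.Surjective g) {n : ℕ} (hC : ExtVanishes R M C n) :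
    ExtVanishes R M A (n + 1) := by
  intro x
  have : CategoryTheory.Injective (ModuleCat.of R B) :=
    Module.injective_object_of_injective_module R B
  obtain ⟨y, rfl⟩ := Ext.covariant_sequence_exact₁ _ (exists_shortExact f g hf hfg hg) x
    (Ext.eq_zero_of_injective _) (n₀ := n) rfl
  rw [hC y, Ext.zero_comp]

theorem ExtVanishes.one_of_exists_lift [Module.Injective R B] {M : Type u} [AddCommGroup M]
    [Module R M] (hf : Function.Injective f) (hfg : Function.Exact f g)
    (hg : Function.Surjective g) (h : ∀ h : M →ₗ[R] C, ∃ k : M →ₗ[R] B, ∀ m, g (k m) = h m) :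
    ExtVanishes R M A 1 := by
  intro x
  have hS := exists_shortExact f g hf hfg hg
  have : CategoryTheory.Injective (ModuleCat.of R B) :=
    Module.injective_object_of_injective_module R B
  obtain ⟨y, rfl⟩ := Ext.covariant_sequence_exact₁ _ hS x
    (Ext.eq_zero_of_injective _) (n₀ := 0) rfl
  obtain ⟨a, rfl⟩ := Ext.homEquiv₀.symm.surjective y
  obtain ⟨k, hk⟩ := h a.hom
  have : a = ModuleCat.ofHom k ≫ ModuleCat.ofHom g := by ext x; exact (hk x).symm
  change (Ext.mk₀ a).comp hS.extClass _ = 0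
  rw [this, ← Ext.mk₀_comp_mk₀, Ext.comp_assoc_of_second_deg_zero]
  have := hS.comp_extClass
  dsimp at this
  rw [this, Ext.comp_zero]

/-- Dualizing a free presentation of `X` embeds `X⁺` in an injective module with another character
module as cokernel. Flatness lifts maps into that cokernel, which gives degree 1; dimension shifting
gives the rest. -/
theorem IsFlat.extVanishes {M : Type u} [AddCommGroup M] [Module R M] (hM : IsFlat R M) (n : ℕ) :
    ∀ (X : Type u) [AddCommGroup X] [Module Rᵐᵒᵖ X],
      ExtVanishes R M (RightDual X) (n + 1) := by
  induction n with
  | zero =>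
    intro X _ _
    have hq : Function.Surjective (Finsupp.linearCombination Rᵐᵒᵖ (id : X → X)) :=
      Finsupp.linearCombination_id_surjective Rᵐᵒᵖ X
    have := injective_rightDual (R := R) (E := X →₀ Rᵐᵒᵖ)
    refine ExtVanishes.one_of_exists_lift (RightDual.map_injective _ hq)
      (RightDual.map_exact (LinearMap.exact_subtype_ker_map _))
      (RightDual.map_surjective _ (Submodule.injective_subtype _))
      (hM.exists_hom_lift _ (Submodule.injective_subtype _))
  | succ n ih =>
    intro X _ _
    have hq : Function.Surjective (Finsupp.linearCombination Rᵐᵒᵖ (id : X → X)) :=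
      Finsupp.linearCombination_id_surjective Rᵐᵒᵖ X
    have := injective_rightDual (R := R) (E := X →₀ Rᵐᵒᵖ)
    exact ExtVanishes.of_injective_coresolution (RightDual.map_injective _ hq)
      (RightDual.map_exact (LinearMap.exact_subtype_ker_map _))
      (RightDual.map_surjective _ (Submodule.injective_subtype _)) (ih _)

end Ext

/-! ### Tor-acyclic modules, flat coresolutions and Gorenstein flatness. -/

section Resolutions

variable {R : Type u} [Ring R]

/-- The sequence `0 → A → B → C → 0` is exact. -/
structure IsShortExact {A B C : Type u} [AddCommGroup A] [AddCommGroup B] [AddCommGroup C]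
    [Module R A] [Module R B] [Module R C] (f : A →ₗ[R] B) (g : B →ₗ[R] C) : Prop where
  injective : Function.Injective f
  exact : Function.Exact f g
  surjective : Function.Surjective g

variable (R) in
/-- `Ext^n_R(M, E⁺) = 0`, that is `Tor_n^R(E, M) = 0`, for all `n > 0` and all injective right
modules `E`. -/
def IsTorAcyclic (M : Type u) [AddCommGroup M] [Module R M] : Prop :=
  ∀ (n : ℕ) (E : Type u) [AddCommGroup E] [Module Rᵐᵒᵖ E], Module.Injective Rᵐᵒᵖ E →
    ExtVanishes R M (RightDual E) (n + 1)

/-- There is an exact sequence `0 → A → F → B → 0` with `F` flat. -/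
def FlatStep (A B : ModuleCat.{u} R) : Prop :=
  ∃ (F : ModuleCat.{u} R) (f : A →ₗ[R] F) (g : F →ₗ[R] B), IsFlat R F ∧ IsShortExact f g

variable {A B C M N : Type u} [AddCommGroup A] [AddCommGroup B] [AddCommGroup C]
  [AddCommGroup M] [AddCommGroup N] [Module R A] [Module R B] [Module R C]
  [Module R M] [Module R N]

theorem isShortExact_ker (g : B →ₗ[R] C) (hg : Function.Surjective g) :
    IsShortExact (LinearMap.ker g).subtype g :=
  ⟨Submodule.injective_subtype _, LinearMap.exact_subtype_ker_map g, hg⟩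

theorem isShortExact_range (f : A →ₗ[R] B) (hf : Function.Injective f) :
    IsShortExact f (LinearMap.range f).mkQ :=
  ⟨hf, fun x => by rw [Submodule.mkQ_apply, Submodule.Quotient.mk_eq_zero]; rfl,
    Submodule.mkQ_surjective _⟩

theorem isFlat_of_projective [Module.Projective R M] : IsFlat R M :=
  isFlat_of_exists_hom_lift fun _ _ _ _ _ _ f hf g => by
    obtain ⟨k, hk⟩ := Module.projective_lifting_property (RightDual.map f) g
      (RightDual.map_surjective f hf)
    exact ⟨k, LinearMap.congr_fun hk⟩

theorem IsFlat.isTorAcyclic (h : IsFlat R M) : IsTorAcyclic R M :=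
  fun n E _ _ _ => h.extVanishes n E

theorem ExtVanishes.congr (e : A ≃ₗ[R] B) {n : ℕ} (h : ExtVanishes R A N n) :
    ExtVanishes R B N n := by
  intro x
  have h1 : ModuleCat.ofHom e.symm.toLinearMap ≫ ModuleCat.ofHom e.toLinearMap =
      𝟙 (ModuleCat.of R B) := by ext x; exact e.apply_symm_apply x
  rw [← Ext.mk₀_id_comp x, ← h1, ← Ext.mk₀_comp_mk₀_assoc,
    h (Ext.comp _ x _), Ext.comp_zero]

theorem IsTorAcyclic.congr (e : A ≃ₗ[R] B) (h : IsTorAcyclic R A) : IsTorAcyclic R B :=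
  fun n E _ _ hE => (h n E hE).congr e

theorem IsTorAcyclic.left {f : A →ₗ[R] B} {g : B →ₗ[R] C} (h : IsShortExact f g)
    (hB : IsTorAcyclic R B) (hC : IsTorAcyclic R C) : IsTorAcyclic R A :=
  fun n E _ _ hE => (hB n E hE).left h.injective h.exact h.surjective (hC (n + 1) E hE)

theorem IsTorAcyclic.exists_flatStep {M : ModuleCat.{u} R} (h : IsTorAcyclic R M) :
    ∃ K : ModuleCat.{u} R, IsTorAcyclic R K ∧ FlatStep K M := by
  have hs := isShortExact_ker _ (Finsupp.linearCombination_id_surjective R M)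
  have hF : IsFlat R (M →₀ R) := isFlat_of_projective
  exact ⟨ModuleCat.of R (LinearMap.ker (Finsupp.linearCombination R (id : M → M))),
    hF.isTorAcyclic.left hs h, ModuleCat.of R (M →₀ R), _, _, hF, hs⟩

theorem IsGorensteinFlat.congr (e : M ≃ₗ[R] N) (h : IsGorensteinFlat R M) :
    IsGorensteinFlat R N := by
  obtain ⟨F, d, h1, h2, ⟨i⟩, h3⟩ := h
  exact ⟨F, d, h1, h2, ⟨e.symm.trans i⟩, h3⟩

/-- Iterated choices to the right (inside `P`) and to the left (inside `Q`) are glued at `x`. -/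
theorem exists_int_chain {α : Type*} (r : α → α → Prop) (P Q : α → Prop)
    (hP : ∀ x, P x → ∃ y, P y ∧ r x y) (hQ : ∀ x, Q x → ∃ y, Q y ∧ r y x) {x : α} (hx : P x)
    (hx' : Q x) : ∃ N : ℤ → α, N 1 = x ∧ ∀ n, (P (N n) ∨ Q (N n)) ∧ r (N n) (N (n + 1)) := by
  choose! s hs hsr using hP
  choose! t ht htr using hQ
  have hsx (k : ℕ) : P (s^[k] x) := by
    induction k with
    | zero => exact hx
    | succ k ih => rw [Function.iterate_succ_apply']; exact hs _ ih
  have htx (k : ℕ) : Q (t^[k] x) := by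
    induction k with
    | zero => exact hx'
    | succ k ih => rw [Function.iterate_succ_apply']; exact ht _ ih
  let N : ℤ → α := fun n => match n with
    | Int.ofNat k => s^[k] x
    | Int.negSucc k => t^[k + 1] x
  have key (n : ℤ) : (P (N n) ∨ Q (N n)) ∧ r (N n) (N (n + 1)) := by
    match n with
    | Int.ofNat k =>
      refine ⟨Or.inl (hsx k), ?_⟩
      change r (s^[k] x) (s^[k + 1] x)
      rw [Function.iterate_succ_apply']
      exact hsr _ (hsx k)
    | Int.negSucc k =>
      refine ⟨Or.inr (htx (k + 1)), ?_⟩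
      have : N (Int.negSucc k + 1) = t^[k] x := by cases k <;> rfl
      rw [this]
      change r (t^[k + 1] x) (t^[k] x)
      rw [Function.iterate_succ_apply']
      exact htr _ (htx k)
  -- The shift puts `x` at index 1, where the image of `F 0 → F 1` will sit.
  refine ⟨fun n => N (n - 1), rfl, fun n => ?_⟩
  have := key (n - 1)
  rwa [sub_add_eq_add_sub] at this

/-- The short exact sequences are spliced. A map `F (n + 1) → E⁺` that kills the image factors
through `N (n + 2)`, and it extends to `F (n + 2)` because `Ext¹(N (n + 3), E⁺) = 0`. -/
theorem isGorensteinFlat_of_chain (N : ℤ → ModuleCat.{u} R) (hN : ∀ n, IsTorAcyclic R (N n))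
    (h : ∀ n, FlatStep (N n) (N (n + 1))) : IsGorensteinFlat R (N 1) := by
  choose F f g hF hfg using h
  have hd (n : ℤ) : Function.Exact (f (n + 1) ∘ₗ g n) (f (n + 1 + 1) ∘ₗ g (n + 1)) := by
    intro y
    rw [LinearMap.comp_apply, map_eq_zero_iff _ (hfg _).injective, (hfg (n + 1)).exact y]
    constructor
    · rintro ⟨x, rfl⟩
      obtain ⟨z, rfl⟩ := (hfg n).surjective x
      exact ⟨z, rfl⟩
    · rintro ⟨z, rfl⟩
      exact ⟨g n z, rfl⟩
  refine ⟨F, fun n => f (n + 1) ∘ₗ g n, hF, hd, ⟨?_⟩, ?_⟩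
  · refine (LinearEquiv.ofInjective (f 1) (hfg 1).injective).trans
      (LinearEquiv.ofEq _ _ ?_)
    exact (LinearMap.range_comp_of_range_eq_top (f 1)
      (LinearMap.range_eq_top.2 (hfg 0).surjective)).symm
  · intro E _ _ hE n
    refine tensor_exact_of_hom_factor (hd n).apply_apply_eq_zero fun φ hφ => ?_
    have hker : LinearMap.ker (g (n + 1)) ≤ LinearMap.ker φ := fun y hy => by
      obtain ⟨x, rfl⟩ := ((hfg (n + 1)).exact y).1 hy
      obtain ⟨z, rfl⟩ := (hfg n).surjective x
      exact hφ z
    let e := (g (n + 1)).quotKerEquivOfSurjective (hfg (n + 1)).surjective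
    obtain ⟨k, hk⟩ := ExtVanishes.exists_extension (hfg (n + 1 + 1)).injective
      (hfg (n + 1 + 1)).exact (hfg (n + 1 + 1)).surjective (hN _ 0 E hE)
      (Submodule.liftQ _ φ hker ∘ₗ e.symm.toLinearMap)
    refine ⟨k, fun y => (hk _).trans ?_⟩
    have : e.symm (g (n + 1) y) = Submodule.Quotient.mk y := e.symm_apply_eq.2 rfl
    rw [LinearMap.comp_apply, LinearEquiv.coe_coe, this]
    rfl

/-- A class of acyclic modules that has flat coresolutions inside the class consists of
Gorenstein flat modules. -/
theorem isGorensteinFlat_of_class (W : ModuleCat.{u} R → Prop)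
    (hW : ∀ M, W M → IsTorAcyclic R M) (hs : ∀ M, W M → ∃ K, W K ∧ FlatStep M K)
    {M : ModuleCat.{u} R} (hM : W M) : IsGorensteinFlat R M := by
  obtain ⟨N, rfl, hN⟩ := exists_int_chain FlatStep W (fun M => IsTorAcyclic R M) hs
    (fun _ h => h.exists_flatStep) hM (hW M hM)
  exact isGorensteinFlat_of_chain N (fun n => (hN n).1.elim (hW _) id) fun n => (hN n).2

/-- In degree 1, exactness under `E ⊗ -` extends maps from an image into `E⁺` over the next flat
module. Higher degrees shift down to the preceding image, so all images are treated at once. -/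
theorem isTorAcyclic_range {F : ℤ → ModuleCat.{u} R} {d : ∀ n : ℤ, F n →ₗ[R] F (n + 1)}
    (hF : ∀ n, IsFlat R (F n)) (hd : ∀ n, Function.Exact (d n) (d (n + 1)))
    (hE : ∀ (E : Type u) [AddCommGroup E] [Module Rᵐᵒᵖ E], Module.Injective Rᵐᵒᵖ E →
      ∀ n, Function.Exact (Tensor.map (LinearMap.id : E →ₗ[Rᵐᵒᵖ] E) (d n))
        (Tensor.map (LinearMap.id : E →ₗ[Rᵐᵒᵖ] E) (d (n + 1)))) (n : ℤ) :
    IsTorAcyclic R (LinearMap.range (d n)) := by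
  have hs (n : ℤ) : IsShortExact (LinearMap.range (d n)).subtype (d (n + 1)).rangeRestrict :=
    ⟨Submodule.injective_subtype _, fun y =>
      (Subtype.ext_iff.trans (hd n y)).trans
        ⟨fun h => ⟨⟨y, h⟩, rfl⟩, by rintro ⟨x, rfl⟩; exact x.2⟩,
      LinearMap.surjective_rangeRestrict _⟩
  intro k
  induction k generalizing n with
  | zero =>
    intro E _ _ hE'
    obtain ⟨m, rfl⟩ : ∃ m, n = m + 1 + 1 := ⟨n - 1 - 1, by ring⟩
    refine ExtVanishes.of_exists_extension (hs (m + 1)).injective (hs (m + 1)).exact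
      (hs (m + 1)).surjective ((hF _).isTorAcyclic 0 E hE') fun h => ?_
    obtain ⟨k, hk⟩ := exists_hom_factor_of_tensor_exact (hE E hE' m)
      (h ∘ₗ (d (m + 1)).rangeRestrict) fun x => by
        rw [LinearMap.comp_apply, ← map_zero h]
        exact congrArg h (Subtype.ext ((hd m).apply_apply_eq_zero x))
    refine ⟨k, ?_⟩
    rintro ⟨_, x, rfl⟩
    exact hk x
  | succ k ih =>
    intro E _ _ hE'
    obtain ⟨m, rfl⟩ : ∃ m, n = m + 1 := ⟨n - 1, by ring⟩
    exact (ih m E hE').right (hs m).injective (hs m).exact (hs m).surjective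
      ((hF _).isTorAcyclic (k + 1) E hE')

theorem IsGorensteinFlat.isTorAcyclic (h : IsGorensteinFlat R M) : IsTorAcyclic R M := by
  obtain ⟨F, d, hF, hd, ⟨e⟩, hE⟩ := h
  exact (isTorAcyclic_range hF hd hE 0).congr e.symm

/-- The cokernel is the next image in the complex, and the same complex shifted by one witnesses
that it is Gorenstein flat. -/
theorem IsGorensteinFlat.exists_right (h : IsGorensteinFlat R M) :
    ∃ (F K : ModuleCat.{u} R) (f : M →ₗ[R] F) (g : F →ₗ[R] K),
      IsFlat R F ∧ IsGorensteinFlat R K ∧ IsShortExact f g := by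
  obtain ⟨F, d, hF, hd, ⟨e⟩, hE⟩ := h
  refine ⟨F (0 + 1), ModuleCat.of R (LinearMap.range (d (0 + 1))),
    (LinearMap.range (d 0)).subtype ∘ₗ e.toLinearMap, (d (0 + 1)).rangeRestrict, hF _,
    ⟨fun n => F (n + 1), fun n => d (n + 1), fun n => hF _, fun n => hd _,
      ⟨LinearEquiv.refl _ _⟩, fun E _ _ hE' n => hE E hE' _⟩,
    (Submodule.injective_subtype _).comp e.injective, fun y => ?_,
    LinearMap.surjective_rangeRestrict _⟩
  refine (Subtype.ext_iff.trans (hd 0 y)).trans ⟨?_, ?_⟩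
  · intro hy
    exact ⟨e.symm ⟨y, hy⟩, by simp⟩
  · rintro ⟨x, rfl⟩
    exact (e x).2

theorem IsFlat.isGorensteinFlat (h : IsFlat R M) : IsGorensteinFlat R M := by
  have h0 (Z : Type u) [AddCommGroup Z] [Module R Z] [Subsingleton Z] : IsFlat R Z :=
    isFlat_of_projective
  refine isGorensteinFlat_of_class (M := ModuleCat.of R M) (fun M => IsFlat R M)
    (fun M hM => hM.isTorAcyclic) (fun M hM => ⟨ModuleCat.of R PUnit, h0 _, M, LinearMap.id, 0, hM,
      Function.injective_id, fun x => ⟨fun _ => ⟨x, rfl⟩, fun _ => rfl⟩, fun x => ⟨0, rfl⟩⟩) h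

/-- Over a left GF-closed ring the kernel of an epimorphism of Gorenstein flat modules is
Gorenstein flat. -/
theorem IsGorensteinFlat.of_shortExact_right (hR : IsLeftGFClosed R) {f : A →ₗ[R] B}
    {g : B →ₗ[R] C} (h : IsShortExact f g) (hB : IsGorensteinFlat R B)
    (hC : IsGorensteinFlat R C) : IsGorensteinFlat R A := by
  obtain ⟨F, K, i, p, hF, hK, hip⟩ := hB.exists_right
  have hif : Function.Injective (i ∘ₗ f) := hip.injective.comp h.injective
  have hs := isShortExact_range (i ∘ₗ f) hif
  -- With `A ⊆ B ⊆ F`, the quotient `F / A` is an extension of `F / B ≅ K` by `B / A ≅ C`.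
  have hQ : IsGorensteinFlat R (F ⧸ LinearMap.range (i ∘ₗ f)) := by
    let S := LinearMap.range (i ∘ₗ f)
    have hgS : LinearMap.ker g ≤ LinearMap.ker (S.mkQ ∘ₗ i) := fun b hb => by
      obtain ⟨a, rfl⟩ := (h.exact b).1 hb
      exact (Submodule.Quotient.mk_eq_zero S).2 ⟨a, rfl⟩
    have hpS : S ≤ LinearMap.ker p := by
      rintro _ ⟨a, rfl⟩
      exact hip.exact.apply_apply_eq_zero _
    let e := g.quotKerEquivOfSurjective h.surjective
    let α : C →ₗ[R] F ⧸ S := (LinearMap.ker g).liftQ (S.mkQ ∘ₗ i) hgS ∘ₗ e.symm.toLinearMap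
    have hα (b : B) : α (g b) = S.mkQ (i b) := by
      have : e.symm (g b) = Submodule.Quotient.mk b := e.symm_apply_eq.2 rfl
      change (LinearMap.ker g).liftQ (S.mkQ ∘ₗ i) hgS (e.symm (g b)) = _
      rw [this]
      rfl
    refine hR C (F ⧸ S) K α (S.liftQ p hpS) ?_ ?_ ?_ hC hK
    · rw [injective_iff_map_eq_zero]
      intro c hc
      obtain ⟨b, rfl⟩ := h.surjective c
      rw [hα, Submodule.mkQ_apply, Submodule.Quotient.mk_eq_zero] at hc
      obtain ⟨a, ha⟩ := hc
      rw [← hip.injective ha]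
      exact h.exact.apply_apply_eq_zero a
    · intro y
      obtain ⟨x, rfl⟩ := S.mkQ_surjective y
      refine (hip.exact x).trans ⟨?_, ?_⟩
      · rintro ⟨b, rfl⟩
        exact ⟨g b, hα b⟩
      · rintro ⟨c, hc⟩
        obtain ⟨b, rfl⟩ := h.surjective c
        rw [hα, Submodule.mkQ_apply, Submodule.mkQ_apply, Submodule.Quotient.eq] at hc
        obtain ⟨a, ha⟩ := hc
        exact ⟨b - f a, by rw [map_sub]; exact sub_eq_of_eq_add' (sub_eq_iff_eq_add.1 ha.symm)⟩
    · intro k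
      obtain ⟨x, rfl⟩ := hip.surjective k
      exact ⟨S.mkQ x, rfl⟩
  -- The class is large enough to contain `A` and every Gorenstein flat module, so it is closed
  -- under taking the flat cosyzygies used here.
  refine isGorensteinFlat_of_class (M := ModuleCat.of R A)
    (fun M => IsTorAcyclic R M ∧ ∃ K : ModuleCat.{u} R, IsGorensteinFlat R K ∧ FlatStep M K)
    (fun M hM => hM.1) ?_
    ⟨hB.isTorAcyclic.left h hC.isTorAcyclic, ModuleCat.of R (F ⧸ LinearMap.range (i ∘ₗ f)), hQ, F,
      _, _, hF, hs⟩
  rintro M ⟨-, K, hK, hMK⟩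
  obtain ⟨F, K', i, p, hF, hK', hip⟩ := hK.exists_right
  exact ⟨K, ⟨hK.isTorAcyclic, K', hK', F, i, p, hF, hip⟩, hMK⟩

end Resolutions

/-! ### Direct sums and direct summands of Gorenstein flat modules. -/

section Dimension

variable {R : Type u} [Ring R]
variable {A B C M N : Type u} [AddCommGroup A] [AddCommGroup B] [AddCommGroup C]
  [AddCommGroup M] [AddCommGroup N] [Module R A] [Module R B] [Module R C]
  [Module R M] [Module R N]

theorem lmap_exact {ι : Type*} {A B C : ι → Type*} [∀ i, AddCommGroup (A i)]
    [∀ i, AddCommGroup (B i)] [∀ i, AddCommGroup (C i)] [∀ i, Module R (A i)]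
    [∀ i, Module R (B i)] [∀ i, Module R (C i)] {f : ∀ i, A i →ₗ[R] B i}
    {g : ∀ i, B i →ₗ[R] C i} (h : ∀ i, Function.Exact (f i) (g i)) :
    Function.Exact (DirectSum.lmap f) (DirectSum.lmap g) := by
  rw [LinearMap.exact_iff, DirectSum.ker_lmap, DirectSum.range_lmap]
  simp_rw [fun i => LinearMap.exact_iff.1 (h i)]

theorem isShortExact_lmap {ι : Type u} {A B C : ι → Type u} [∀ i, AddCommGroup (A i)]
    [∀ i, AddCommGroup (B i)] [∀ i, AddCommGroup (C i)] [∀ i, Module R (A i)]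
    [∀ i, Module R (B i)] [∀ i, Module R (C i)] {f : ∀ i, A i →ₗ[R] B i}
    {g : ∀ i, B i →ₗ[R] C i} (h : ∀ i, IsShortExact (f i) (g i)) :
    IsShortExact (DirectSum.lmap f) (DirectSum.lmap g) :=
  ⟨(DirectSum.lmap_injective f).2 fun i => (h i).injective, lmap_exact fun i => (h i).exact,
    (DirectSum.lmap_surjective g).2 fun i => (h i).surjective⟩

/-- The lifting criterion for flatness can be checked on each summand, since maps out of a direct
sum are families of maps. -/
theorem isFlat_directSum {ι : Type u} {F : ι → Type u} [∀ i, AddCommGroup (F i)]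
    [∀ i, Module R (F i)] (h : ∀ i, IsFlat R (F i)) : IsFlat R (⨁ i, F i) := by
  classical
  refine isFlat_of_exists_hom_lift fun E X _ _ _ _ f hf g => ?_
  choose k hk using fun i => (h i).exists_hom_lift f hf (g ∘ₗ DirectSum.lof R ι F i)
  refine ⟨DirectSum.toModule R ι _ k, fun m => ?_⟩
  have : RightDual.map f ∘ₗ DirectSum.toModule R ι _ k = g := by
    refine DirectSum.linearMap_ext R fun i => LinearMap.ext fun x => ?_
    rw [LinearMap.comp_apply, LinearMap.comp_apply, DirectSum.toModule_lof]
    exact hk i x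
  exact LinearMap.congr_fun this m

/-- The sum of the complexes works: the factorization form of exactness under `E ⊗ -` is again
checked summand by summand. -/
theorem IsGorensteinFlat.directSum {ι : Type u} {G : ι → Type u} [∀ i, AddCommGroup (G i)]
    [∀ i, Module R (G i)] (h : ∀ i, IsGorensteinFlat R (G i)) :
    IsGorensteinFlat R (⨁ i, G i) := by
  classical
  choose F d hF hd e hE using h
  have hd' (n : ℤ) : Function.Exact (DirectSum.lmap fun i => d i n)
      (DirectSum.lmap fun i => d i (n + 1)) := lmap_exact fun i => hd i n
  refine ⟨fun n => ModuleCat.of R (⨁ i, F i n), fun n => DirectSum.lmap fun i => d i n,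
    fun n => isFlat_directSum fun i => hF i n, hd', ⟨?_⟩, ?_⟩
  · let j : ∀ i, G i →ₗ[R] F i (0 + 1) := fun i =>
      (LinearMap.range (d i 0)).subtype ∘ₗ (e i).some.toLinearMap
    have hj (i : ι) : LinearMap.range (j i) = LinearMap.range (d i 0) := by
      rw [LinearMap.range_comp_of_range_eq_top _ (LinearEquiv.range _), Submodule.range_subtype]
    refine (LinearEquiv.ofInjective (DirectSum.lmap j) ((DirectSum.lmap_injective j).2 fun i =>
      (Submodule.injective_subtype _).comp (e i).some.injective)).trans
      (LinearEquiv.ofEq _ _ ?_)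
    rw [DirectSum.range_lmap, DirectSum.range_lmap]
    simp_rw [hj]
  · intro E _ _ hE' n
    refine tensor_exact_of_hom_factor (hd' n).apply_apply_eq_zero fun φ hφ => ?_
    have hφ' (i : ι) (x : F i n) :
        φ (DirectSum.lof R ι (fun i => F i (n + 1)) i (d i n x)) = 0 := by
      rw [← DirectSum.lmap_lof (fun i => d i n)]
      exact hφ _
    choose k hk using fun i => exists_hom_factor_of_tensor_exact (hE i E hE' n)
      (φ ∘ₗ DirectSum.lof R ι (fun i => F i (n + 1)) i) (hφ' i)
    refine ⟨DirectSum.toModule R ι _ k, fun y => ?_⟩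
    have : DirectSum.toModule R ι _ k ∘ₗ DirectSum.lmap (fun i => d i (n + 1)) = φ := by
      refine DirectSum.linearMap_ext R fun i => LinearMap.ext fun x => ?_
      rw [LinearMap.comp_apply, LinearMap.comp_apply, DirectSum.lmap_lof, DirectSum.toModule_lof]
      exact hk i x
    exact LinearMap.congr_fun this y

/-- Gorenstein flat modules over a left GF-closed ring are closed under direct summands. -/
theorem IsGorensteinFlat.of_retract (hR : IsLeftGFClosed R) (i : A →ₗ[R] M) (p : M →ₗ[R] A)
    (hpi : ∀ a, p (i a) = a) (h : IsGorensteinFlat R M) : IsGorensteinFlat R A := by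
  have hD : IsGorensteinFlat R (ℕ →₀ M) := by
    classical
    exact (IsGorensteinFlat.directSum fun _ : ULift.{u} ℕ => h).congr
      ((finsuppLEquivDirectSum R M (ULift.{u} ℕ)).symm.trans
        (Finsupp.domLCongr Equiv.ulift))
  let e : M →ₗ[R] M := i ∘ₗ p
  have he (x : M) : e (e x) = e x := congrArg i (hpi (p x))
  let E : (ℕ →₀ M) →ₗ[R] (ℕ →₀ M) := Finsupp.mapRange.linearMap e
  -- With `M = A ⊕ B` and `e` the projection to `A`, `φ` shifts the `A`-components down by one and
  -- fixes the `B`-components, so its kernel is the copy of `A` in position 0.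
  let φ : (ℕ →₀ M) →ₗ[R] (ℕ →₀ M) :=
    LinearMap.id - E + E ∘ₗ Finsupp.lcomapDomain Nat.succ Nat.succ_injective
  have hφ (x : ℕ →₀ M) (n : ℕ) : φ x n = x n - e (x n) + e (x (n + 1)) := rfl
  refine hD.of_shortExact_right hR (f := Finsupp.lsingle 0 ∘ₗ i) (g := φ) ⟨?_, ?_, ?_⟩ hD
  · exact (Finsupp.single_injective 0).comp (Function.LeftInverse.injective hpi)
  · intro x
    constructor
    · intro hx
      have h0 (n : ℕ) : x n - e (x n) + e (x (n + 1)) = 0 := by rw [← hφ, hx]; rfl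
      have h1 (n : ℕ) : e (x (n + 1)) = 0 := by
        have := congrArg e (h0 n)
        rwa [map_add, map_sub, he, he, sub_self, zero_add, map_zero] at this
      have h2 (n : ℕ) : x n = e (x n) := by
        have := h0 n
        rwa [h1, add_zero, sub_eq_zero] at this
      refine ⟨p (x 0), Finsupp.ext fun n => ?_⟩
      cases n with
      | zero => exact (Finsupp.single_eq_same).trans (h2 0).symm
      | succ n =>
        rw [h2 (n + 1), h1]
        exact Finsupp.single_eq_of_ne (by simp)
    · rintro ⟨a, rfl⟩
      refine Finsupp.ext fun n => ?_
      rw [hφ]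
      have h1 : (Finsupp.lsingle 0 ∘ₗ i : A →ₗ[R] (ℕ →₀ M)) a (n + 1) = 0 :=
        Finsupp.single_eq_of_ne (by simp)
      rw [h1, map_zero, add_zero]
      cases n with
      | zero =>
        have h0 : (Finsupp.lsingle 0 ∘ₗ i : A →ₗ[R] (ℕ →₀ M)) a 0 = i a := Finsupp.single_eq_same
        rw [h0]
        exact sub_eq_zero.2 (congrArg i (hpi a)).symm
      | succ n =>
        have h0 : (Finsupp.lsingle 0 ∘ₗ i : A →ₗ[R] (ℕ →₀ M)) a (n + 1) = 0 :=
          Finsupp.single_eq_of_ne (by simp)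
        rw [h0, map_zero, sub_zero]
        rfl
  · intro y
    -- The preimage moves the `A`-components up by one and keeps the `B`-components.
    refine ⟨Finsupp.mapDomain Nat.succ (E y) + (y - E y), Finsupp.ext fun n => ?_⟩
    have hE (n : ℕ) : E y n = e (y n) := rfl
    have hs (n : ℕ) : Finsupp.mapDomain Nat.succ (E y) (n + 1) = e (y n) :=
      Finsupp.mapDomain_apply Nat.succ_injective _ _
    have h0 : Finsupp.mapDomain Nat.succ (E y) 0 = 0 :=
      Finsupp.mapDomain_of_notMem_range _ _ (by simp)
    rw [hφ]
    cases n <;> simp [hs, h0, hE, he]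

theorem IsGorensteinFlat.prod (hR : IsLeftGFClosed R) (hA : IsGorensteinFlat R A)
    (hB : IsGorensteinFlat R B) : IsGorensteinFlat R (A × B) :=
  hR A (A × B) B (LinearMap.inl R A B) (LinearMap.snd R A B) LinearMap.inl_injective
    Function.Exact.inl_snd LinearMap.snd_surjective hA hB

/-! ### Gorenstein flat dimension: syzygies, retracts and resolutions. -/

/-- There is an exact sequence `0 → G n → ⋯ → G 0 → M → 0` with all `G i` Gorenstein flat,
by recursion on `n`. -/
def GorFlatDimLE : ℕ → ModuleCat.{u} R → Prop
  | 0, M => IsGorensteinFlat R M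
  | n + 1, M => ∃ (G K : ModuleCat.{u} R) (f : K →ₗ[R] G) (g : G →ₗ[R] M),
      IsGorensteinFlat R G ∧ GorFlatDimLE n K ∧ IsShortExact f g

theorem IsShortExact.comp_equiv {f : A →ₗ[R] B} {g : B →ₗ[R] C} (h : IsShortExact f g)
    (e : C ≃ₗ[R] N) : IsShortExact f (e.toLinearMap ∘ₗ g) :=
  ⟨h.injective, fun y => (map_eq_zero_iff e e.injective).trans (h.exact y),
    e.surjective.comp h.surjective⟩

theorem GorFlatDimLE.congr {n : ℕ} {M N : ModuleCat.{u} R} (e : M ≃ₗ[R] N)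
    (h : GorFlatDimLE n M) : GorFlatDimLE n N := by
  cases n with
  | zero => exact IsGorensteinFlat.congr e h
  | succ n =>
    obtain ⟨G, K, f, g, hG, hK, hfg⟩ := h
    exact ⟨G, K, f, _, hG, hK, hfg.comp_equiv e⟩

theorem GorFlatDimLE.succ {n : ℕ} {M : ModuleCat.{u} R} (h : GorFlatDimLE n M) :
    GorFlatDimLE (n + 1) M := by
  induction n generalizing M with
  | zero =>
    have h0 : IsFlat R PUnit.{u + 1} := isFlat_of_projective
    exact ⟨M, ModuleCat.of R PUnit, 0, LinearMap.id, h, h0.isGorensteinFlat,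
      fun _ _ _ => rfl, fun x => ⟨fun hx => ⟨0, hx.symm⟩, by rintro ⟨_, rfl⟩; rfl⟩,
      Function.surjective_id⟩
  | succ n ih =>
    obtain ⟨G, K, f, g, hG, hK, hfg⟩ := h
    exact ⟨G, K, f, g, hG, ih hK, hfg⟩

theorem GorFlatDimLE.mono {m n : ℕ} (hmn : m ≤ n) {M : ModuleCat.{u} R} (h : GorFlatDimLE m M) :
    GorFlatDimLE n M :=
  Nat.le_induction h (fun _ _ => GorFlatDimLE.succ) n hmn

theorem GorFlatDimLE.directSum {ι : Type u} {n : ℕ} {M : ι → ModuleCat.{u} R}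
    (h : ∀ i, GorFlatDimLE n (M i)) : GorFlatDimLE n (ModuleCat.of R (⨁ i, M i)) := by
  induction n generalizing M with
  | zero => exact IsGorensteinFlat.directSum h
  | succ n ih =>
    choose G K f g hG hK hfg using h
    exact ⟨ModuleCat.of R (⨁ i, G i), ModuleCat.of R (⨁ i, K i), DirectSum.lmap f,
      DirectSum.lmap g, IsGorensteinFlat.directSum hG, ih hK, isShortExact_lmap hfg⟩

/-- The factor `P` is absorbed into the first term of the resolution; the kernel does not change. -/
theorem GorFlatDimLE.prod_projective (hR : IsLeftGFClosed R) {n : ℕ} {L : ModuleCat.{u} R}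
    (h : GorFlatDimLE n L) (P : Type u) [AddCommGroup P] [Module R P] [Module.Projective R P] :
    GorFlatDimLE n (ModuleCat.of R (L × P)) := by
  have hP : IsGorensteinFlat R P := IsFlat.isGorensteinFlat isFlat_of_projective
  cases n with
  | zero => exact IsGorensteinFlat.prod hR h hP
  | succ n =>
    obtain ⟨G, K, f, g, hG, hK, hfg⟩ := h
    refine ⟨ModuleCat.of R (G × P), K, LinearMap.inl R G P ∘ₗ f, g.prodMap LinearMap.id,
      hG.prod hR hP, hK, LinearMap.inl_injective.comp hfg.injective, ?_,
      hfg.surjective.prodMap Function.surjective_id⟩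
    rintro ⟨x, p⟩
    constructor
    · intro hx
      obtain ⟨y, rfl⟩ := (hfg.exact x).1 (congrArg Prod.fst hx)
      exact ⟨y, Prod.ext rfl (congrArg Prod.snd hx).symm⟩
    · rintro ⟨y, hy⟩
      rw [← hy]
      exact Prod.ext (hfg.exact.apply_apply_eq_zero y) rfl

/-- If `H` covers `B` with kernel `Y`, then the kernel of `H → C` is Gorenstein flat and covers `ker
g` with the same kernel `Y`. -/
theorem GorFlatDimLE.ker (hR : IsLeftGFClosed R) {n : ℕ} {B : ModuleCat.{u} R} (g : B →ₗ[R] C)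
    (hg : Function.Surjective g) (hB : GorFlatDimLE n B) (hC : IsGorensteinFlat R C) :
    GorFlatDimLE n (ModuleCat.of R (LinearMap.ker g)) := by
  cases n with
  | zero => exact IsGorensteinFlat.of_shortExact_right hR (isShortExact_ker g hg) hB hC
  | succ n =>
    obtain ⟨H, Y, a, b, hH, hY, hab⟩ := hB
    have h0 (y : Y) : b (a y) = 0 := hab.exact.apply_apply_eq_zero y
    refine ⟨ModuleCat.of R (LinearMap.ker (g ∘ₗ b)), Y,
      a.codRestrict _ fun y => by rw [LinearMap.mem_ker, LinearMap.comp_apply, h0, map_zero],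
      b.restrict fun x hx => hx, IsGorensteinFlat.of_shortExact_right hR
        (isShortExact_ker (g ∘ₗ b) (hg.comp hab.surjective)) hH hC, hY, ?_, ?_, ?_⟩
    · exact fun x y hxy => hab.injective (congrArg Subtype.val hxy)
    · rintro ⟨x, hx⟩
      refine (Subtype.ext_iff.trans (hab.exact x)).trans ⟨?_, ?_⟩
      · rintro ⟨y, rfl⟩
        exact ⟨y, rfl⟩
      · rintro ⟨y, hy⟩
        exact ⟨y, congrArg Subtype.val hy⟩
    · rintro ⟨y, hy⟩
      obtain ⟨x, rfl⟩ := hab.surjective y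
      exact ⟨⟨x, hy⟩, rfl⟩

/-- A first syzygy of a module of Gorenstein flat dimension at most `n + 1` has Gorenstein flat
dimension at most `n`. -/
theorem GorFlatDimLE.syzygy (hR : IsLeftGFClosed R) {n : ℕ} {M : ModuleCat.{u} R}
    (h : GorFlatDimLE (n + 1) M) {P : Type u} [AddCommGroup P] [Module R P]
    [Module.Projective R P] (g : P →ₗ[R] M) (hg : Function.Surjective g) :
    GorFlatDimLE n (ModuleCat.of R (LinearMap.ker g)) := by
  obtain ⟨G, L, l, q, hG, hL, hlq⟩ := h
  obtain ⟨s, hs⟩ := Module.projective_lifting_property q g hlq.surjective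
  have hqs (p : P) : q (s p) = g p := LinearMap.congr_fun hs p
  have hql (x : L) : q (l x) = 0 := hlq.exact.apply_apply_eq_zero x
  -- Schanuel: as `l` is injective, `ker ψ` projects isomorphically onto `ker g`, while `ψ` maps
  -- onto the Gorenstein flat `G`.
  let ψ : (L × P) →ₗ[R] G := l.coprod s
  have hψ (x : L) (p : P) : ψ (x, p) = l x + s p := rfl
  have hψs : Function.Surjective ψ := fun y => by
    obtain ⟨p, hp⟩ := hg (q y)
    obtain ⟨x, hx⟩ := (hlq.exact (y - s p)).1 (by rw [map_sub, hqs, hp, sub_self])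
    exact ⟨(x, p), by rw [hψ, hx, sub_add_cancel]⟩
  have hmem (z : L × P) (hz : z ∈ LinearMap.ker ψ) : z.2 ∈ LinearMap.ker g := by
    have : q (l z.1 + s z.2) = 0 := (congrArg q hz).trans (map_zero q)
    rwa [map_add, hql, hqs, zero_add] at this
  refine (GorFlatDimLE.ker hR (B := ModuleCat.of R (L × P)) ψ hψs
    (hL.prod_projective hR P) hG).congr
    (LinearEquiv.ofBijective ((LinearMap.snd R L P).restrict hmem) ⟨?_, ?_⟩)
  · rw [injective_iff_map_eq_zero]
    rintro ⟨⟨x, p⟩, hz⟩ hxp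
    obtain rfl : p = 0 := congrArg Subtype.val hxp
    have : l x + s 0 = 0 := hz
    rw [map_zero, add_zero, map_eq_zero_iff l hlq.injective] at this
    exact Subtype.ext (Prod.ext this rfl)
  · rintro ⟨p, hp⟩
    obtain ⟨x, hx⟩ := (hlq.exact (s p)).1 ((hqs p).trans hp)
    refine ⟨⟨(-x, p), ?_⟩, rfl⟩
    rw [LinearMap.mem_ker, hψ, map_neg, hx, neg_add_cancel]

/-- By induction on `n`: the free cover of `M` is chosen so that the syzygy of `A` is a retract of
that of `M`. -/
theorem GorFlatDimLE.of_retract (hR : IsLeftGFClosed R) {n : ℕ} {A M : ModuleCat.{u} R}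
    (i : A →ₗ[R] M) (p : M →ₗ[R] A) (hpi : ∀ a, p (i a) = a) (h : GorFlatDimLE n M) :
    GorFlatDimLE n A := by
  induction n generalizing A M with
  | zero => exact IsGorensteinFlat.of_retract hR i p hpi h
  | succ n ih =>
    let a : (A →₀ R) →ₗ[R] A := Finsupp.linearCombination R id
    have ha : Function.Surjective a := Finsupp.linearCombination_id_surjective R A
    let m : (M →₀ R) →ₗ[R] M := Finsupp.linearCombination R id
    have hm : Function.Surjective m := Finsupp.linearCombination_id_surjective R M
    -- The two factors cover the images of `i ∘ p` and `1 - i ∘ p`. Since `p (g (x, y)) = a x`,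
    -- inclusion and projection of the first factor restrict to the kernels.
    let g : ((A →₀ R) × (M →₀ R)) →ₗ[R] M := (i ∘ₗ a).coprod (m - i ∘ₗ p ∘ₗ m)
    have hg (x : A →₀ R) (y : M →₀ R) : g (x, y) = i (a x) + (m y - i (p (m y))) := rfl
    have hgs : Function.Surjective g := fun z => by
      obtain ⟨x, hx⟩ := ha (p z)
      obtain ⟨y, hy⟩ := hm z
      exact ⟨(x, y), by rw [hg, hx, hy, add_sub_cancel]⟩
    have hA : IsFlat R (A →₀ R) := isFlat_of_projective
    refine ⟨ModuleCat.of R (A →₀ R), ModuleCat.of R (LinearMap.ker a), _, a,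
      hA.isGorensteinFlat, ?_, isShortExact_ker a ha⟩
    refine ih (M := ModuleCat.of R (LinearMap.ker g))
      ((LinearMap.inl R (A →₀ R) (M →₀ R)).restrict fun x hx => ?_)
      ((LinearMap.fst R (A →₀ R) (M →₀ R)).restrict ?_) (fun _ => rfl) (h.syzygy hR g hgs)
    · rw [LinearMap.mem_ker] at hx ⊢
      rw [LinearMap.inl_apply, hg, hx, map_zero, map_zero, map_zero, map_zero, sub_zero, add_zero]
    · rintro ⟨x, y⟩ hxy
      have : p (i (a x) + (m y - i (p (m y)))) = 0 := (congrArg p hxy).trans (map_zero p)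
      rwa [map_add, map_sub, hpi, hpi, sub_self, add_zero] at this

/-- A resolution is cut at `ker ε`, or spliced from a short exact sequence and a resolution of its
kernel. -/
theorem hasGFResolution_iff {n : ℕ} (M : ModuleCat.{u} R) :
    HasGFResolution R M n ↔ GorFlatDimLE n M := by
  induction n generalizing M with
  | zero =>
    constructor
    · rintro ⟨G, d, ε, hG, h0, hε, hd, -⟩
      have := h0 1 one_pos
      refine IsGorensteinFlat.congr (LinearEquiv.ofBijective ε ⟨?_, hε⟩) (hG 0 le_rfl)
      rw [injective_iff_map_eq_zero]
      intro x hx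
      obtain ⟨y, rfl⟩ := (hd x).1 hx
      rw [Subsingleton.elim y 0, map_zero]
    · intro h
      let G : ℕ → ModuleCat.{u} R := fun
        | 0 => M
        | _ + 1 => ModuleCat.of R PUnit
      have hs (i : ℕ) : Subsingleton (G (i + 1)) := inferInstanceAs (Subsingleton PUnit)
      refine ⟨G, fun _ => 0, LinearMap.id, fun i hi => ?_, fun i hi => ?_,
        Function.surjective_id, fun x => ⟨fun hx => ⟨0, hx.symm⟩, by rintro ⟨_, rfl⟩; rfl⟩,
        fun i x => ⟨fun _ => ⟨0, Subsingleton.elim _ _⟩, fun _ => rfl⟩⟩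
      · obtain rfl := Nat.le_zero.1 hi
        exact h
      · obtain ⟨j, rfl⟩ := Nat.exists_eq_succ_of_ne_zero hi.ne'
        exact hs j
  | succ n ih =>
    constructor
    · rintro ⟨G, d, ε, hG, h0, hε, hd, hd'⟩
      refine ⟨G 0, ModuleCat.of R (LinearMap.ker ε), _, ε, hG 0 (Nat.zero_le _), (ih _).1 ?_,
        isShortExact_ker ε hε⟩
      refine ⟨fun i => G (i + 1), fun i => d (i + 1),
        (d 0).codRestrict _ fun x => hd.apply_apply_eq_zero x, fun i hi => hG _ (by omega),
        fun i hi => h0 _ (by omega), ?_, fun x => Subtype.ext_iff.trans (hd' 0 x),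
        fun i => hd' _⟩
      rintro ⟨y, hy⟩
      obtain ⟨x, rfl⟩ := (hd y).1 hy
      exact ⟨x, rfl⟩
    · rintro ⟨G, K, f, g, hG, hK, hfg⟩
      obtain ⟨G', d, ε, hG', h0, hε, hd, hd'⟩ := (ih K).2 hK
      let H : ℕ → ModuleCat.{u} R := fun
        | 0 => G
        | i + 1 => G' i
      let δ : ∀ i, H (i + 1) →ₗ[R] H i := fun
        | 0 => f ∘ₗ ε
        | i + 1 => d i
      refine ⟨H, δ, g, fun i hi => ?_, fun i hi => ?_, hfg.surjective, fun y => ?_, fun i => ?_⟩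
      · cases i with
        | zero => exact hG
        | succ i => exact hG' i (by omega)
      · cases i with
        | zero => omega
        | succ i => exact h0 i (by omega)
      · refine (hfg.exact y).trans ⟨?_, ?_⟩
        · rintro ⟨k, rfl⟩
          obtain ⟨x, rfl⟩ := hε k
          exact ⟨x, rfl⟩
        · rintro ⟨x, rfl⟩
          exact ⟨ε x, rfl⟩
      · cases i with
        | zero => exact fun y => (map_eq_zero_iff f hfg.injective).trans (hd y)
        | succ i => exact hd' i

theorem gfd_le_iff {n : ℕ} : gfd R M ≤ n ↔ GorFlatDimLE n (ModuleCat.of R M) := by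
  constructor
  · intro h
    have hne : {k : ℕ∞ | ∃ n : ℕ, k = n ∧ HasGFResolution R M n}.Nonempty := by
      by_contra hn
      rw [gfd, Set.not_nonempty_iff_eq_empty.1 hn, sInf_empty] at h
      exact ENat.natCast_ne_top n (top_le_iff.1 h)
    obtain ⟨m, hm, hM⟩ := csInf_mem hne
    rw [gfd, hm, Nat.cast_le] at h
    exact ((hasGFResolution_iff (ModuleCat.of R M)).1 hM).mono h
  · intro h
    exact sInf_le ⟨n, rfl, (hasGFResolution_iff (ModuleCat.of R M)).2 h⟩

end Dimension

end GorFlat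

theorem proposition2p10 (R : Type u) [Ring R] (hR : GorFlat.IsLeftGFClosed R)
    (ι : Type u) (M : ι → Type u) [∀ i, AddCommGroup (M i)] [∀ i, Module R (M i)] :
    GorFlat.gfd R (⨁ i, M i) = ⨆ i, GorFlat.gfd R (M i) := by
  classical
  -- The two sides are compared through their upper bounds, of which only the finite ones matter.
  refine eq_of_forall_ge_iff fun c => ?_
  induction c using ENat.recTopCoe with
  | top => simp
  | coe n =>
    simp_rw [iSup_le_iff, GorFlat.gfd_le_iff]
    refine ⟨fun h i => ?_, fun h => GorFlat.GorFlatDimLE.directSum h⟩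
    exact GorFlat.GorFlatDimLE.of_retract hR (A := ModuleCat.of R (M i))
      (M := ModuleCat.of R (⨁ i, M i)) (DirectSum.lof R ι M i) (DirectSum.component R ι M i)
      (fun a => DirectSum.component.lof_self R i a) h
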